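/- Let $n\ge 1$, let $z=(z_1,\dots,z_n)$, and let $\Delta=\sum_{i=1}^n \frac{\partial^2}{\partial z_i^2}$ be the Laplace operator on the formal power series algebra $\mathbb{C}[[z]]$. A series $P\in\mathbb{C}[[z]]$ is called Hessian nilpotent if its Hessian matrix $\left(\frac{\partial^2 P}{\partial z_i\partial z_j}\right)_{1\le i,j\le n}$ is a nilpotent matrix over $\mathbb{C}[[z]]$. Let $P\in\mathbb{C}[[z]]$ have order at least $2$, that is, $P$ has no terms of total degree less than $2$ (the zero series is allowed). Then the following statements are equivalent: 1. $P$ is Hessian nilpotent. 2. $\Delta^m (P^m)=0$ for all integers $m\ge 1$. 3. $\Delta^m (P^m)=0$ for all integers $1\le m\le n$. -/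

import Mathlib

/-- The Laplace operator `∑ i, ∂²/∂zᵢ²` on formal power series `ℂ[[z₁, …, zₙ]]`. -/
noncomputable def formalLaplacian {n : ℕ} :
    MvPowerSeries (Fin n) ℂ →ₗ[ℂ] MvPowerSeries (Fin n) ℂ :=
  ∑ i : Fin n, (MvPowerSeries.pderiv ℂ i).toLinearMap ∘ₗ (MvPowerSeries.pderiv ℂ i).toLinearMap

theorem formalLaplacian_apply {n : ℕ} (P : MvPowerSeries (Fin n) ℂ) :
    formalLaplacian P = ∑ i : Fin n, MvPowerSeries.pderiv ℂ i (MvPowerSeries.pderiv ℂ i P) := by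
  simp [formalLaplacian]

/-- The Hessian matrix `(∂²P/∂zᵢ∂zⱼ)` of a formal power series, with entries in `ℂ[[z]]`. -/
noncomputable def formalHessian {n : ℕ} (P : MvPowerSeries (Fin n) ℂ) :
    Matrix (Fin n) (Fin n) (MvPowerSeries (Fin n) ℂ) :=
  Matrix.of fun i j => MvPowerSeries.pderiv ℂ i (MvPowerSeries.pderiv ℂ j P)

/-- `P` is Hessian nilpotent (HN): its Hessian matrix is nilpotent. -/
def IsHessianNilpotent {n : ℕ} (P : MvPowerSeries (Fin n) ℂ) : Prop :=
  IsNilpotent (formalHessian P)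

/-! In characteristic zero, a matrix of size n is nilpotent iff the traces of its first n powers
vanish. So it suffices that, once the traces of lower powers vanish, Δᵏ⁺¹(Pᵏ⁺¹) is a nonzero
multiple of tr (Hess P)ᵏ⁺¹. The link is the Hamilton–Jacobi deformation Q of P, a power series in t
with 2 ∂Q/∂t = ∑ (∂ₗQ)². The tᵏ-coefficient of ΔQ is computed twice: from the evolution of the
Hessian traces (`coeff_trace_hessian_pow`) and from that of the powers of Q
(`coeff_pow_hamiltonJacobi`). `laplacian_pow_apply_pow` compares the results. -/

/-! ### Trace criterion for nilpotency -/

namespace Matrix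

variable {ι K : Type*} [Fintype ι] [DecidableEq ι]

/-- By Cayley–Hamilton, q can be reduced modulo the characteristic polynomial, so powers up to the
size suffice. -/
theorem trace_aeval_X_mul_eq_zero [Field K] {M : Matrix ι ι K}
    (h : ∀ m, 1 ≤ m → m ≤ Fintype.card ι → (M ^ m).trace = 0) (q : Polynomial K) :
    (Polynomial.aeval M (Polynomial.X * q)).trace = 0 := by
  have hlow : ∀ q : Polynomial K, q.natDegree < Fintype.card ι →
      (Polynomial.aeval M (Polynomial.X * q)).trace = 0 := by
    intro q hq
    rw [Polynomial.aeval_def, Polynomial.X_mul, Polynomial.eval₂_mul_X,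
      Polynomial.eval₂_eq_sum_range, Finset.sum_mul, trace_sum]
    refine Finset.sum_eq_zero fun i hi => ?_
    rw [mul_assoc, ← pow_succ, ← Algebra.smul_def, trace_smul, h _ (by omega), smul_zero]
    have := Finset.mem_range.mp hi
    omega
  rcases isEmpty_or_nonempty ι with hι | hι
  · simp [trace]
  have hmod : Polynomial.aeval M (Polynomial.X * q) =
      Polynomial.aeval M (Polynomial.X * (q %ₘ M.charpoly)) := by
    conv_lhs => rw [← Polynomial.modByMonic_add_div q M.charpoly]
    simp [mul_add, aeval_self_charpoly]
  rw [hmod]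
  apply hlow
  have h1 : M.charpoly ≠ 1 := by
    intro h1
    have := M.charpoly_natDegree_eq_dim
    rw [h1, Polynomial.natDegree_one] at this
    exact Fintype.card_ne_zero this.symm
  exact (Polynomial.natDegree_modByMonic_lt q M.charpoly_monic h1).trans_eq
    M.charpoly_natDegree_eq_dim

/-- Splitting the characteristic polynomial as Xᵃg with X ∤ g, Bézout gives an idempotent e, the
projection onto the part where M is invertible. In characteristic zero an idempotent of trace zero
is zero. -/
theorem isNilpotent_of_trace_pow_eq_zero_of_field [Field K] [CharZero K] {M : Matrix ι ι K}
    (h : ∀ m, 1 ≤ m → m ≤ Fintype.card ι → (M ^ m).trace = 0) : IsNilpotent M := by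
  obtain ⟨g, hg, hndvd⟩ := Polynomial.exists_eq_pow_rootMultiplicity_mul_and_not_dvd M.charpoly
    M.charpoly_monic.ne_zero 0
  set a := Polynomial.rootMultiplicity 0 M.charpoly
  rw [Polynomial.C_0, sub_zero] at hg hndvd
  -- The exponent a + 1 leaves a factor X in e even when a = 0, so that its trace vanishes.
  have hcop : IsCoprime (Polynomial.X ^ (a + 1)) g :=
    ((Polynomial.prime_X.irreducible.coprime_iff_not_dvd).mpr hndvd).pow_left
  obtain ⟨u, v, huv⟩ := hcop
  have hann : Polynomial.aeval M (Polynomial.X ^ a * g) = 0 := by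
    rw [← hg, aeval_self_charpoly]
  set e := Polynomial.aeval M (u * Polynomial.X ^ (a + 1)) with he
  have hidem : IsIdempotentElem e := by
    have : u * Polynomial.X ^ (a + 1) * (u * Polynomial.X ^ (a + 1)) =
        u * Polynomial.X ^ (a + 1) - (u * v * Polynomial.X) * (Polynomial.X ^ a * g) := by
      linear_combination (u * Polynomial.X ^ (a + 1)) * huv
    rw [IsIdempotentElem, he, ← map_mul, this, map_sub, map_mul _ _ (_ * g), hann, mul_zero,
      sub_zero]
  have htr : e.trace = 0 := by
    rw [he, show u * Polynomial.X ^ (a + 1) = Polynomial.X * (u * Polynomial.X ^ a) by ring]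
    exact trace_aeval_X_mul_eq_zero h _
  have he0 : e = 0 := by
    have h1 : IsIdempotentElem (toLin' e) := by
      rw [IsIdempotentElem, Module.End.mul_eq_comp, ← toLin'_mul, hidem.eq]
    have h2 := (LinearMap.IsIdempotentElem.trace_eq_zero_iff h1).mp (by rw [trace_toLin'_eq, htr])
    simpa using h2
  refine ⟨a, ?_⟩
  have : M ^ a = Polynomial.aeval M (Polynomial.X ^ a * (u * Polynomial.X ^ (a + 1)) +
      v * (Polynomial.X ^ a * g)) := by
    rw [show Polynomial.X ^ a * (u * Polynomial.X ^ (a + 1)) +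
      v * (Polynomial.X ^ a * g) = Polynomial.X ^ a by linear_combination Polynomial.X ^ a * huv]
    simp
  rw [this, map_add, map_mul, map_mul _ v, hann, ← he, he0, mul_zero, mul_zero, add_zero]

/-- A square matrix over a domain of characteristic zero is nilpotent as soon as the traces of its
powers up to its size vanish. -/
theorem isNilpotent_of_trace_pow_eq_zero {R : Type*} [CommRing R] [IsDomain R] [CharZero R]
    {M : Matrix ι ι R} (h : ∀ m, 1 ≤ m → m ≤ Fintype.card ι → (M ^ m).trace = 0) :
    IsNilpotent M := by
  have : CharZero (FractionRing R) := inferInstance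
  set f := algebraMap R (FractionRing R)
  have hM : IsNilpotent (f.mapMatrix M) := by
    refine isNilpotent_of_trace_pow_eq_zero_of_field fun m h1 h2 => ?_
    rw [← map_pow, RingHom.mapMatrix_apply, ← AddMonoidHom.map_trace, h m h1 h2, map_zero]
  exact (IsNilpotent.map_iff
    (map_injective (IsFractionRing.injective R (FractionRing R)))).mp hM

end Matrix

/-! ### Derivations, traces and Laplacians -/

namespace Derivation

variable {ι R B : Type*} [Fintype ι] [CommRing R] [CommRing B] [Algebra R B]

theorem map_matrix_mul (D : Derivation R B B) (M N : Matrix ι ι B) :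
    (M * N).map D = M.map D * N + M * N.map D := by
  ext i j
  simp only [Matrix.map_apply, Matrix.mul_apply, Matrix.add_apply, map_sum, leibniz, smul_eq_mul,
    Finset.sum_add_distrib]
  rw [add_comm]
  simp_rw [mul_comm]

/-- `M.map D` need not commute with M, but cyclicity of the trace gathers the powers of M. The
factor C absorbs one M at each induction step. -/
theorem trace_mul_map_matrix_pow [DecidableEq ι] (D : Derivation R B B) (M : Matrix ι ι B) (j : ℕ)
    (C : Matrix ι ι B) (hC : Commute C M) :
    (C * (M ^ (j + 1)).map D).trace = (j + 1) * (C * M ^ j * M.map D).trace := by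
  induction j generalizing C with
  | zero => simp
  | succ j ih =>
    rw [pow_succ M (j + 1), map_matrix_mul, mul_add, Matrix.trace_add, ← mul_assoc,
      Matrix.trace_mul_comm, ← mul_assoc,
      ih (M * C) ((Commute.refl M).mul_left hC), ← mul_assoc C, ← hC.eq, mul_assoc C M, ← pow_succ']
    push_cast
    ring

theorem apply_trace_matrix_pow [DecidableEq ι] (D : Derivation R B B) (M : Matrix ι ι B) (j : ℕ) :
    D (M ^ (j + 1)).trace = (j + 1) * (M ^ j * M.map D).trace := by
  have := trace_mul_map_matrix_pow D M j 1 (Commute.one_left M)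
  rw [one_mul, one_mul] at this
  rw [← this]
  simp [Matrix.trace]

/-- The Hessian matrix of an element with respect to a family of derivations. -/
def hessian (D : ι → Derivation R B B) (Q : B) : Matrix ι ι B :=
  Matrix.of fun i j => D i (D j Q)

/-- The Laplace operator of a family of derivations. -/
def laplacian (D : ι → Derivation R B B) : B →ₗ[R] B :=
  ∑ i, (D i : B →ₗ[R] B) ∘ₗ (D i : B →ₗ[R] B)

theorem laplacian_apply (D : ι → Derivation R B B) (Q : B) :
    laplacian D Q = ∑ i, D i (D i Q) := by
  simp [laplacian]

theorem trace_hessian (D : ι → Derivation R B B) (Q : B) :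
    (hessian D Q).trace = laplacian D Q := by
  simp [laplacian_apply, hessian, Matrix.trace]

theorem laplacian_pow_succ (D : ι → Derivation R B B) (Q : B) (v : ℕ) :
    laplacian D (Q ^ (v + 1)) = (v + 1) * laplacian D Q * Q ^ v +
      (v + 1) * (v * Q ^ (v - 1)) * ∑ i, D i Q ^ 2 := by
  simp only [laplacian_apply, Finset.mul_sum, Finset.sum_mul, ← Finset.sum_add_distrib]
  refine Finset.sum_congr rfl fun i _ => ?_
  rw [leibniz_pow, Nat.add_sub_cancel]
  simp only [nsmul_eq_mul, smul_eq_mul, leibniz, leibniz_pow, map_natCast]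
  push_cast
  ring

end Derivation

/-! ### Consequences of the Hamilton–Jacobi equation -/

namespace Derivation

variable {ι R B : Type*} [Fintype ι] [CommRing R] [CommRing B] [Algebra R B]

/-- Differentiating the equation twice, products of second derivatives give the square of the
Hessian and third derivatives give the transport term. -/
theorem map_hessian_of_hamiltonJacobi [IsAddTorsionFree B] {D : ι → Derivation R B B}
    (hD : ∀ i j x, D i (D j x) = D j (D i x)) {T : Derivation R B B}
    (hT : ∀ i x, T (D i x) = D i (T x)) {Q : B} (hQ : 2 * T Q = ∑ l, D l Q ^ 2) :
    (hessian D Q).map T =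
      hessian D Q * hessian D Q + ∑ l, D l Q • (hessian D Q).map (D l) := by
  ext i j
  apply nsmul_right_injective two_ne_zero
  have h1 : (2 : ℕ) • T (D i (D j Q)) = D i (D j (2 * T Q)) := by
    rw [hT, hT, two_mul, two_nsmul, map_add, map_add]
  simp only [hessian, Matrix.map_apply, Matrix.of_apply, Matrix.add_apply, Matrix.mul_apply,
    Matrix.sum_apply, Matrix.smul_apply, smul_eq_mul]
  rw [h1, hQ, map_sum, map_sum, ← Finset.sum_add_distrib, Finset.smul_sum]
  refine Finset.sum_congr rfl fun l _ => ?_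
  simp only [sq, leibniz, smul_eq_mul, map_add]
  rw [hD j l Q, hD l i (D j Q), hD l j Q, hD i l Q]
  simp only [nsmul_eq_mul]
  push_cast
  ring

theorem apply_trace_hessian_pow_of_hamiltonJacobi [DecidableEq ι] [IsAddTorsionFree B]
    {D : ι → Derivation R B B}
    (hD : ∀ i j x, D i (D j x) = D j (D i x)) {T : Derivation R B B}
    (hT : ∀ i x, T (D i x) = D i (T x)) {Q : B} (hQ : 2 * T Q = ∑ l, D l Q ^ 2) (j : ℕ) :
    T (hessian D Q ^ (j + 1)).trace = (j + 1) * (hessian D Q ^ (j + 2)).trace +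
      ∑ l, D l Q * D l (hessian D Q ^ (j + 1)).trace := by
  simp only [apply_trace_matrix_pow, map_hessian_of_hamiltonJacobi hD hT hQ, mul_add,
    Matrix.trace_add, Finset.mul_sum, Matrix.trace_sum, Matrix.mul_smul, Matrix.trace_smul,
    smul_eq_mul]
  rw [← pow_two, ← pow_add]
  congr 1
  exact Finset.sum_congr rfl fun l _ => by ring

theorem laplacian_pow_succ_of_hamiltonJacobi {D : ι → Derivation R B B} {T : Derivation R B B}
    {Q : B} (hQ : 2 * T Q = ∑ l, D l Q ^ 2) (v : ℕ) :
    laplacian D (Q ^ (v + 1)) =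
      2 * (v + 1) * T (Q ^ v) + (v + 1) * (laplacian D Q * Q ^ v) := by
  rw [laplacian_pow_succ, ← hQ, leibniz_pow]
  simp only [nsmul_eq_mul, smul_eq_mul]
  ring

end Derivation

/-! ### Power series in t and the formal solution -/

open PowerSeries

namespace Derivation

section

variable {ι R A : Type*} [CommRing R] [CommRing A] [Algebra R A]

/-- The coefficientwise extension of a derivation to formal power series. -/
noncomputable def mapPowerSeries (d : Derivation R A A) : Derivation R A⟦X⟧ A⟦X⟧ :=
  Derivation.mk'
    { toFun := fun f => PowerSeries.mk fun n => d (coeff n f)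
      map_add' := fun f g => by ext; simp
      map_smul' := fun r f => by ext; simp } fun f g => by
    ext n
    simp only [LinearMap.coe_mk, AddHom.coe_mk, coeff_mk,
      smul_eq_mul, map_add, coeff_mul, map_sum, leibniz, Finset.sum_add_distrib]
    congr 1
    exact (Finset.Nat.sum_antidiagonal_swap
      (f := fun p => coeff p.1 g * d (coeff p.2 f)))

@[simp]
theorem coeff_mapPowerSeries (d : Derivation R A A) (f : A⟦X⟧) (n : ℕ) :
    coeff n (d.mapPowerSeries f) = d (coeff n f) :=
  coeff_mk n fun n => d (coeff n f)

variable (R A) in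
/-- The derivative with respect to the variable of `A⟦X⟧`, as a derivation over `R`. -/
noncomputable def powerSeriesDerivative : Derivation R A⟦X⟧ A⟦X⟧ :=
  (PowerSeries.derivative A).restrictScalars R

@[simp]
theorem coeff_powerSeriesDerivative (f : A⟦X⟧) (n : ℕ) :
    coeff n (powerSeriesDerivative R A f) = coeff (n + 1) f * (n + 1) :=
  coeff_derivative f n

theorem powerSeriesDerivative_mapPowerSeries (d : Derivation R A A) (f : A⟦X⟧) :
    powerSeriesDerivative R A (d.mapPowerSeries f) =
      d.mapPowerSeries (powerSeriesDerivative R A f) := by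
  ext n
  have h : d ((n : A) + 1) = 0 := by simp
  simp only [coeff_powerSeriesDerivative, coeff_mapPowerSeries, leibniz, h, smul_eq_mul]
  ring

theorem mapPowerSeries_comm {d₁ d₂ : Derivation R A A} (h : ∀ x, d₁ (d₂ x) = d₂ (d₁ x))
    (f : A⟦X⟧) :
    d₁.mapPowerSeries (d₂.mapPowerSeries f) = d₂.mapPowerSeries (d₁.mapPowerSeries f) := by
  ext n
  simp [h]

theorem coeff_laplacian_mapPowerSeries [Fintype ι] (d : ι → Derivation R A A) (f : A⟦X⟧) (n : ℕ) :
    coeff n (laplacian (fun i => (d i).mapPowerSeries) f) = laplacian d (coeff n f) := by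
  simp [laplacian_apply]

end

section

variable {ι K A : Type*} [Fintype ι] [Field K] [CharZero K] [CommRing A] [Algebra K A]

/-- The coefficients of the solution `Q` of the Hamilton–Jacobi equation
`2 ∂Q/∂t = ∑ᵢ (∂ᵢ Q)²` with initial value `P`. -/
noncomputable def hamiltonJacobiCoeff (d : ι → Derivation K A A) (P : A) : ℕ → A
  | 0 => P
  | n + 1 => (1 / (2 * (n + 1)) : K) • ∑ l, ∑ p ∈ (Finset.HasAntidiagonal.antidiagonal n).attach,
      d l (hamiltonJacobiCoeff d P p.1.1) * d l (hamiltonJacobiCoeff d P p.1.2)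
decreasing_by
  · have := Finset.HasAntidiagonal.mem_antidiagonal.mp p.2
    omega
  · have := Finset.HasAntidiagonal.mem_antidiagonal.mp p.2
    omega

theorem exists_hamiltonJacobi (d : ι → Derivation K A A) (P : A) :
    ∃ Q : A⟦X⟧, coeff 0 Q = P ∧
      2 * powerSeriesDerivative K A Q = ∑ l, (d l).mapPowerSeries Q ^ 2 := by
  refine ⟨PowerSeries.mk (hamiltonJacobiCoeff d P), ?_, ?_⟩
  · rw [coeff_mk, hamiltonJacobiCoeff]
  · ext n
    have hn : (2 * ((n : K) + 1)) * (1 / (2 * (n + 1))) = 1 :=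
      mul_one_div_cancel (mul_ne_zero two_ne_zero n.cast_add_one_ne_zero)
    have key : coeff n (2 * powerSeriesDerivative K A (PowerSeries.mk (hamiltonJacobiCoeff d P))) =
        (2 * ((n : K) + 1)) • hamiltonJacobiCoeff d P (n + 1) := by
      rw [two_mul, map_add, coeff_powerSeriesDerivative, coeff_mk, Algebra.smul_def]
      have hcast : algebraMap K A n = n := _root_.map_natCast _ n
      simp only [map_mul, map_add, map_ofNat, map_one, hcast]
      ring
    rw [key, hamiltonJacobiCoeff, smul_smul, hn, one_smul]
    simp only [map_sum, sq, coeff_mul, coeff_mapPowerSeries, coeff_mk]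
    refine Finset.sum_congr rfl fun l _ => ?_
    exact Finset.sum_attach (Finset.HasAntidiagonal.antidiagonal n) fun p =>
      d l (hamiltonJacobiCoeff d P p.1) * d l (hamiltonJacobiCoeff d P p.2)

end

end Derivation

/-! ### Coefficients in t and the key identity -/

namespace Derivation

variable {ι K A : Type*} [Fintype ι] [Field K] [CharZero K] [CommRing A]
  [Algebra K A]

theorem coeff_trace_hessian_pow [DecidableEq ι] {d : ι → Derivation K A A}
    (hd : ∀ i j x, d i (d j x) = d j (d i x)) {Q : A⟦X⟧}
    (hQ : 2 * powerSeriesDerivative K A Q = ∑ l, (d l).mapPowerSeries Q ^ 2) {k : ℕ}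
    (hk : ∀ m, 1 ≤ m → m < k → (hessian d (coeff 0 Q) ^ m).trace = 0) (i j : ℕ)
    (hij : i + j + 1 ≤ k) :
    coeff i (hessian (fun l => (d l).mapPowerSeries) Q ^ (j + 1)).trace =
      (i + j).choose i * (hessian d (coeff 0 Q) ^ (i + j + 1)).trace := by
  have : IsAddTorsionFree A⟦X⟧ :=
    have := Module.compHom A⟦X⟧ (algebraMap ℚ K)
    IsAddTorsionFree.of_module_rat _
  have : IsAddTorsionFree A :=
    have := Module.compHom A (algebraMap ℚ K)
    IsAddTorsionFree.of_module_rat _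
  induction i using Nat.strong_induction_on generalizing j with
  | _ i ih =>
  rcases i with _ | i
  · have h0 : (constantCoeff (R := A)).mapMatrix (hessian (fun l => (d l).mapPowerSeries) Q) =
        hessian d (coeff 0 Q) := by
      ext a b
      simp only [RingHom.mapMatrix_apply, Matrix.map_apply, hessian, Matrix.of_apply,
        ← coeff_zero_eq_constantCoeff_apply, coeff_mapPowerSeries]
    rw [coeff_zero_eq_constantCoeff_apply, AddMonoidHom.map_trace, ← RingHom.mapMatrix_apply,
      map_pow, h0]
    simp
  · have hT := congrArg (coeff i) (apply_trace_hessian_pow_of_hamiltonJacobi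
      (D := fun l => (d l).mapPowerSeries)
      (fun a b => mapPowerSeries_comm (hd a b))
      (fun a => powerSeriesDerivative_mapPowerSeries (d a)) hQ j)
    -- The transport term involves only coefficients up to tⁱ, which are multiples of traces of
    -- powers below k.
    have hzero : coeff i (∑ l, (d l).mapPowerSeries Q *
        (d l).mapPowerSeries (hessian (fun l => (d l).mapPowerSeries) Q ^ (j + 1)).trace) = 0 := by
      rw [map_sum]
      refine Finset.sum_eq_zero fun l _ => ?_
      rw [coeff_mul]
      refine Finset.sum_eq_zero fun p hp => ?_
      have hp' := Finset.HasAntidiagonal.mem_antidiagonal.mp hp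
      rw [coeff_mapPowerSeries, coeff_mapPowerSeries, ih p.2 (by omega) j (by omega),
        hk _ (by omega) (by omega), mul_zero, map_zero, mul_zero]
    have hcast : ((j : A⟦X⟧) + 1) = C ((j : A) + 1) := by simp
    rw [coeff_powerSeriesDerivative, map_add, hzero, add_zero, hcast, coeff_C_mul,
      ih i (by omega) (j + 1) (by omega)] at hT
    apply nsmul_right_injective i.succ_ne_zero
    have hch : (((i + 1 + j).choose (i + 1) : ℕ) : A) * (i + 1) = (i + 1 + j).choose i * (j + 1) := by
      have := Nat.choose_succ_right_eq (i + 1 + j) i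
      rw [show i + 1 + j - i = j + 1 by omega] at this
      simpa only [Nat.cast_mul, Nat.cast_add, Nat.cast_one] using congrArg (Nat.cast (R := A)) this
    simp only [nsmul_eq_mul, Nat.succ_eq_add_one, Nat.cast_add, Nat.cast_one]
    rw [mul_comm, hT, show i + (j + 1) = i + 1 + j by omega]
    linear_combination (-(hessian d (coeff 0 Q) ^ (i + 1 + j + 1)).trace) * hch

/-- Since ΔQ vanishes below order k in t, Δ(Qᵛ⁺¹) agrees there with 2(v + 1) ∂(Qᵛ)/∂t. Each step
thus trades one order in t for one Δ and one more power. -/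
theorem coeff_pow_hamiltonJacobi {d : ι → Derivation K A A} {Q : A⟦X⟧}
    (hQ : 2 * powerSeriesDerivative K A Q = ∑ l, (d l).mapPowerSeries Q ^ 2) {k : ℕ}
    (hk : ∀ i < k, coeff i (laplacian (fun l => (d l).mapPowerSeries) Q) = 0) (j v : ℕ)
    (hj : j ≤ k) :
    ((2 ^ j * j.factorial * (v + j).factorial : ℕ) : A) * coeff j (Q ^ v) =
      v.factorial * (laplacian d ^ j) (coeff 0 Q ^ (v + j)) := by
  have : IsAddTorsionFree A :=
    have := Module.compHom A (algebraMap ℚ K)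
    IsAddTorsionFree.of_module_rat _
  induction j generalizing v with
  | zero => simp
  | succ j ih =>
    have h := congrArg (coeff j) (laplacian_pow_succ_of_hamiltonJacobi hQ v)
    have hzero : coeff j (laplacian (fun l => (d l).mapPowerSeries) Q * Q ^ v) = 0 := by
      rw [coeff_mul]
      refine Finset.sum_eq_zero fun p hp => ?_
      have hp' := Finset.HasAntidiagonal.mem_antidiagonal.mp hp
      rw [hk _ (by omega), zero_mul]
    have hc1 : (2 * ((v : A⟦X⟧) + 1)) = C (2 * ((v : A) + 1)) := by
      simp [_root_.map_ofNat C 2]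
    have hc2 : ((v : A⟦X⟧) + 1) = C ((v : A) + 1) := by simp
    rw [coeff_laplacian_mapPowerSeries, map_add, hc1, hc2, coeff_C_mul, coeff_C_mul, hzero,
      mul_zero, add_zero, coeff_powerSeriesDerivative] at h
    have h2 := congrArg (laplacian d) (ih (v + 1) (by omega))
    rw [← nsmul_eq_mul, ← nsmul_eq_mul, map_nsmul, map_nsmul, nsmul_eq_mul, nsmul_eq_mul, h,
      ← Module.End.mul_apply, ← pow_succ', show v + 1 + j = v + (j + 1) by omega] at h2
    apply nsmul_right_injective v.succ_ne_zero
    simp only [nsmul_eq_mul, Nat.factorial_succ v, Nat.factorial_succ j, Nat.succ_eq_add_one,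
      pow_succ (2 : ℕ)] at h2 ⊢
    push_cast at h2 ⊢
    linear_combination h2

/-- If the traces of the powers below `k` of the Hessian matrix of `P` vanish, then `Δᵏ(Pᵏ)` is a
multiple of the trace of the `k`-th power. -/
theorem laplacian_pow_apply_pow [DecidableEq ι] {d : ι → Derivation K A A}
    (hd : ∀ i j x, d i (d j x) = d j (d i x)) {P : A} {k : ℕ}
    (hk : ∀ m, 1 ≤ m → m < k + 1 → (hessian d P ^ m).trace = 0) :
    (laplacian d ^ (k + 1)) (P ^ (k + 1)) =
      ((2 ^ k * k.factorial * (k + 1).factorial : ℕ) : A) * (hessian d P ^ (k + 1)).trace := by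
  obtain ⟨Q, rfl, hQ⟩ := exists_hamiltonJacobi d P
  have htr : ∀ i ≤ k, laplacian d (coeff i Q) = (hessian d (coeff 0 Q) ^ (i + 1)).trace := by
    intro i hi
    have := coeff_trace_hessian_pow hd hQ hk i 0 (by omega)
    rwa [zero_add, pow_one, trace_hessian, coeff_laplacian_mapPowerSeries, add_zero,
      Nat.choose_self, Nat.cast_one, one_mul] at this
  -- Taking v = 1 and j = k gives the tᵏ-coefficient of Q itself; one more Δ makes it that of ΔQ.
  have h := congrArg (laplacian d) (coeff_pow_hamiltonJacobi hQ (k := k) (fun i hi => by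
    rw [coeff_laplacian_mapPowerSeries, htr i hi.le, hk _ (by omega) (by omega)]) k 1 le_rfl)
  rw [Nat.factorial_one, Nat.cast_one, one_mul, pow_one, ← nsmul_eq_mul, map_nsmul, nsmul_eq_mul,
    htr k le_rfl, ← Module.End.mul_apply, ← pow_succ', add_comm 1 k] at h
  exact h.symm

end Derivation

theorem MvPowerSeries.pderiv_comm {σ R : Type*} [CommRing R] (i j : σ) (f : MvPowerSeries σ R) :
    pderiv R i (pderiv R j f) = pderiv R j (pderiv R i f) := by
  classical
  rcases eq_or_ne i j with rfl | hij
  · rfl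
  ext n
  simp only [coeff_pderiv, Finsupp.add_apply, Finsupp.single_eq_of_ne hij,
    Finsupp.single_eq_of_ne hij.symm, add_zero, add_right_comm n]
  ring

theorem theorem4p3 (n : ℕ) (hn : 1 ≤ n) (P : MvPowerSeries (Fin n) ℂ) (hP : 2 ≤ P.order) :
    List.TFAE [
      IsHessianNilpotent P,
      ∀ m : ℕ, 1 ≤ m → (formalLaplacian ^ m) (P ^ m) = 0,
      ∀ m : ℕ, 1 ≤ m → m ≤ n → (formalLaplacian ^ m) (P ^ m) = 0] := by
  set d : Fin n → Derivation ℂ (MvPowerSeries (Fin n) ℂ) (MvPowerSeries (Fin n) ℂ) :=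
    fun i => MvPowerSeries.pderiv ℂ i
  have hd : ∀ i j x, d i (d j x) = d j (d i x) := MvPowerSeries.pderiv_comm
  have hlap : (formalLaplacian : MvPowerSeries (Fin n) ℂ →ₗ[ℂ] _) = Derivation.laplacian d := rfl
  have hhess : formalHessian P = Derivation.hessian d P := rfl
  have : CharZero (MvPowerSeries (Fin n) ℂ) := algebraRat.charZero _
  have : IsDomain (MvPowerSeries (Fin n) ℂ) := NoZeroDivisors.to_isDomain _
  rw [IsHessianNilpotent, hlap, hhess]
  tfae_have 1 → 2 := by
    intro h m hm
    obtain ⟨k, rfl⟩ := Nat.exists_eq_add_of_le' hm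
    have htr : ∀ j, 1 ≤ j → (Derivation.hessian d P ^ j).trace = 0 := fun j hj =>
      (Matrix.isNilpotent_trace_of_isNilpotent (h.pow_of_pos (by omega))).eq_zero
    rw [Derivation.laplacian_pow_apply_pow hd fun j hj _ => htr j hj, htr _ hm, mul_zero]
  tfae_have 2 → 3 := fun h m hm _ => h m hm
  tfae_have 3 → 1 := by
    intro h
    apply Matrix.isNilpotent_of_trace_pow_eq_zero
    rw [Fintype.card_fin]
    intro m
    -- The key identity at m needs the traces of all lower powers to vanish already.
    induction m using Nat.strong_induction_on with
    | _ m ih =>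
    intro hm hmn
    obtain ⟨k, rfl⟩ := Nat.exists_eq_add_of_le' hm
    have hk := h _ hm hmn
    rw [Derivation.laplacian_pow_apply_pow hd fun j hj hjk => ih j hjk hj (by omega)] at hk
    exact (mul_eq_zero.mp hk).resolve_left (Nat.cast_ne_zero.mpr (by positivity))
  tfae_finish
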